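/- Let $p>1$, $f,g,\rho\in C[0,1]$, $d\in C^1(0,1)$, and assume that $\rho>0$ in $(0,1)$ with $\rho(0)=\rho(1)=0$; that $g(0)>0$ and $\int_0^u g(s)\,ds>0$ for every $u\in(0,1]$; and that $d>0$ in $(0,1)$ with $\rho\, d^{\frac1{p-1}}\in L^1(0,1)$. A travelling wave solution (t.w.s.) with speed $c\in\mathbb R$ is a function $u\in C^1(\alpha,\beta)$, where $-\infty\le\alpha<\beta\le+\infty$, with $0<u<1$ in $(\alpha,\beta)$ and $d(u)|u'|^{p-2}u'\in C^1(\alpha,\beta)$, such that $$(d(u)|u'|^{p-2}u')'+(c\,g(u)-f(u))u'+\rho(u)=0\quad\text{in }(\alpha,\beta),$$ $$\lim_{t\to\alpha^+}u(t)=1,\qquad \lim_{t\to\beta^-}u(t)=0,\qquad \lim_{t\to\alpha^+}d(u)|u'|^{p-2}u'=\lim_{t\to\beta^-}d(u)|u'|^{p-2}u'=0.$$ Let $c^*$ be the threshold wave speed, i.e. the infimum of all $c\in\mathbb R$ for which a t.w.s. with speed $c$ exists. Assume that the limit $\ell_0:=\lim_{u\to0^+}\rho(u)\dfrac{d(u)^{\frac1{p-1}}}{u^{\frac1{p-1}}}$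 exists and is finite. Let $u$ be a t.w.s. on $(\alpha,\beta)$ with speed $c>c^*$, and assume that there are constants $\delta,\mu,M>0$ and a function $\xi\in C^1[0,\delta]$ such that $$\mu\,\xi(s)\le d(s)\rho(s)^{p-1}\le M\,\xi(s)\qquad\text{for every } s\in(0,\delta).$$ Then $\beta=+\infty$ if and only if $\displaystyle\int_0^{1/2}\frac{1}{\rho(s)}\,ds=+\infty$. Moreover, whether $\beta$ is finite or not, $\displaystyle\lim_{t\to\beta^-}u'(t)=0$; consequently, if $\beta<+\infty$, the extension of $u$ by $0$ to $(\alpha,+\infty)$ is of class $C^1$. -/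

import Mathlib

open Set Filter Topology MeasureTheory

noncomputable section

/-- The structural hypotheses on the exponent `p` and the coefficients of
`f(u) u_x + g(u) u_τ = [d(u) |u_x|^(p-2) u_x]_x + ρ(u)`:
`p > 1`; `f, g, ρ ∈ C[0,1]`; `d ∈ C¹(0,1)`; `ρ > 0` in `(0,1)` and `ρ(0) = ρ(1) = 0`;
`g(0) > 0` and `∫₀ᵘ g > 0` for `u ∈ (0,1]`; `d > 0` in `(0,1)` and `ρ d^(1/(p-1)) ∈ L¹(0,1)`.
The coefficients are total functions on `ℝ`, but only their values on `[0,1]`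
(on `(0,1)` for `d`) are constrained or used. -/
structure StructuralHypotheses (p : ℝ) (d f g ρ : ℝ → ℝ) : Prop where
  one_lt_p : 1 < p
  f_cont : ContinuousOn f (Icc 0 1)
  g_cont : ContinuousOn g (Icc 0 1)
  ρ_cont : ContinuousOn ρ (Icc 0 1)
  d_C1 : ContDiffOn ℝ 1 d (Ioo 0 1)
  ρ_pos : ∀ u ∈ Ioo (0 : ℝ) 1, 0 < ρ u
  ρ_zero : ρ 0 = 0
  ρ_one : ρ 1 = 0
  g_zero_pos : 0 < g 0
  g_integral_pos : ∀ u ∈ Ioc (0 : ℝ) 1, 0 < ∫ s in (0 : ℝ)..u, g s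
  d_pos : ∀ u ∈ Ioo (0 : ℝ) 1, 0 < d u
  ρd_integrable : IntegrableOn (fun u => ρ u * d u ^ (1 / (p - 1))) (Ioo 0 1)

/-- The open interval `(α, β) ⊆ ℝ` with extended real endpoints. -/
def realInterval (α β : EReal) : Set ℝ := {t : ℝ | α < (t : EReal) ∧ (t : EReal) < β}

/-- The filter `t → α⁺` on `ℝ`, for an extended real `α` (it is `t → -∞` when `α = -∞`). -/
def rightOf (α : EReal) : Filter ℝ := comap ((↑) : ℝ → EReal) (𝓝[>] α)

/-- The filter `t → β⁻` on `ℝ`, for an extended real `β` (it is `t → +∞` when `β = +∞`). -/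
def leftOf (β : EReal) : Filter ℝ := comap ((↑) : ℝ → EReal) (𝓝[<] β)

/-- The flux `d(u(t)) |u'(t)|^(p-2) u'(t)`. It vanishes where `u' = 0`, for every `p > 1`. -/
def flux (p : ℝ) (d u : ℝ → ℝ) (t : ℝ) : ℝ := d (u t) * |deriv u t| ^ (p - 2) * deriv u t

/-- `u` is a travelling wave solution with speed `c`, defined on `(α, β)`. -/
structure IsTravelingWave (p : ℝ) (d f g ρ : ℝ → ℝ) (c : ℝ) (α β : EReal) (u : ℝ → ℝ) :
    Prop where
  lt : α < β
  u_C1 : ContDiffOn ℝ 1 u (realInterval α β)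
  u_mem : ∀ t ∈ realInterval α β, u t ∈ Ioo (0 : ℝ) 1
  flux_C1 : ContDiffOn ℝ 1 (flux p d u) (realInterval α β)
  ode : ∀ t ∈ realInterval α β,
    deriv (flux p d u) t + (c * g (u t) - f (u t)) * deriv u t + ρ (u t) = 0
  u_left : Tendsto u (rightOf α) (𝓝 1)
  u_right : Tendsto u (leftOf β) (𝓝 0)
  flux_left : Tendsto (flux p d u) (rightOf α) (𝓝 0)
  flux_right : Tendsto (flux p d u) (leftOf β) (𝓝 0)

/-- The set of admissible wave speeds. -/
def admissibleSpeeds (p : ℝ) (d f g ρ : ℝ → ℝ) : Set ℝ :=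
  {c : ℝ | ∃ (α β : EReal) (u : ℝ → ℝ), IsTravelingWave p d f g ρ c α β u}

/-- The threshold (minimal) wave speed `c*`: the infimum of the admissible speeds. An admissible
speed satisfies `c ∫₀¹ g > ∫₀¹ f`, so the set is bounded below and, once there is
a travelling wave at all, this is a true infimum. -/
def thresholdSpeed (p : ℝ) (d f g ρ : ℝ → ℝ) : ℝ := sInf (admissibleSpeeds p d f g ρ)

/-- The extension of `u` by the constant value `0` on `[β, ∞)`. -/
def zeroExtension (β : EReal) (u : ℝ → ℝ) (t : ℝ) : ℝ :=
  open Classical in if (t : EReal) < β then u t else 0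

end

/-! A wave is strictly decreasing, so it can be parametrised by its height `s`. With `y(s)` minus
the flux at height `s`, the equation becomes `y' = h - (r / y) ^ q` on `(0, 1)`, where `q = 1 / (p -
1)`, `h = c g - f`, `r = d ρ ^ (p - 1)`, and `y` vanishes at both ends (`exists_isProfile`). The
slope is recovered from `-u' = (y(u) / d(u)) ^ q`, so a two-sided bound `k r ≤ y ≤ K r` near `0`
says exactly that `-u'` is comparable to `ρ(u)` near the front. This gives everything: `u' → 0`
because `ρ(0) = 0`, and the time `∫ ds / (-u')` needed to reach height `0` is infinite exactly when
`∫ 1 / ρ` diverges.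

The function `ξ` is a `C¹` substitute for `r`, so its multiples serve as barriers. The lower bound
(`exists_mul_le`) uses `k ξ` with `k` small, where the singular term forces `y` downwards at a
contact point. For the upper bound, if `ℓ₀ > 0` then `r` is at least linear and `y` at most linear
(`exists_le_mul_of_pos`).

If `ℓ₀ = 0` (`exists_le_mul_of_zero`), the speed matters. Either `y ≤ k ξ` near `0` for a large `k`,
or `y` leaves `0` with slope above some `B` exceeding `h₀(0)`, where `h₀` belongs to a slower
admissible speed. In the second case `y` lies above the slower profile near `0`, which
`not_eventually_lt` forbids: the gap could never close again before `s = 1`. -/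

/-- A solution of the singular first-order problem `y' = h - (r / y) ^ q` on `(0, 1)`, positive
there and vanishing at both endpoints. -/
structure IsProfile (q : ℝ) (h r y : ℝ → ℝ) : Prop where
  cont : ContinuousOn y (Icc 0 1)
  zero : y 0 = 0
  one : y 1 = 0
  pos : ∀ s ∈ Ioo (0 : ℝ) 1, 0 < y s
  deriv : ∀ s ∈ Ioo (0 : ℝ) 1, HasDerivAt y (h s - (r s / y s) ^ q) s

/-! ### Monotonicity, comparison, and limits at `0⁺`. -/

theorem monotoneOn_Icc_of_hasDerivAt {a b : ℝ} {w w' : ℝ → ℝ} (hc : ContinuousOn w (Icc a b))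
    (hd : ∀ x ∈ Ioo a b, HasDerivAt w (w' x) x) (hn : ∀ x ∈ Ioo a b, 0 ≤ w' x) :
    MonotoneOn w (Icc a b) := by
  refine monotoneOn_of_deriv_nonneg (convex_Icc a b) hc ?_ ?_
  · intro x hx
    rw [interior_Icc] at hx
    exact (hd x hx).differentiableAt.differentiableWithinAt
  · intro x hx
    rw [interior_Icc] at hx
    rw [(hd x hx).deriv]
    exact hn x hx

/-- The barrier principle: slopes need comparing only at contact points, where the singular term of
a profile can be evaluated on the barrier. -/
theorem le_of_hasDerivAt_lt {a b : ℝ} {v v' w w' : ℝ → ℝ} (hv : ContinuousOn v (Icc a b))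
    (hv' : ∀ x ∈ Ico a b, HasDerivAt v (v' x) x) (hw : ContinuousOn w (Icc a b))
    (hw' : ∀ x ∈ Ico a b, HasDerivAt w (w' x) x) (hvw : v a ≤ w a)
    (hlt : ∀ x ∈ Ico a b, v x = w x → v' x < w' x) : ∀ x ∈ Icc a b, v x ≤ w x :=
  fun _ hx => image_le_of_deriv_right_lt_deriv_boundary' hv
    (fun x hx => (hv' x hx).hasDerivWithinAt) hvw hw (fun x hx => (hw' x hx).hasDerivWithinAt)
    hlt hx

theorem exists_Ioc_of_eventually_nhdsGT_zero {P : ℝ → Prop} (hP : ∀ᶠ s in 𝓝[>] (0 : ℝ), P s)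
    {δ : ℝ} (hδ : 0 < δ) : ∃ η, 0 < η ∧ η < δ ∧ ∀ s ∈ Ioc 0 η, P s := by
  obtain ⟨η, hη, hP⟩ := mem_nhdsGT_iff_exists_Ioc_subset.1 hP
  have hη' : 0 < η := hη
  refine ⟨min η (δ / 2), by positivity, ?_, fun s hs => hP ⟨hs.1, hs.2.trans (min_le_left _ _)⟩⟩
  exact (min_le_right _ _).trans_lt (half_lt_self hδ)

theorem tendsto_nhdsGT_zero_of_continuousOn {h : ℝ → ℝ} (hh : ContinuousOn h (Icc 0 1)) :
    Tendsto h (𝓝[>] 0) (𝓝 (h 0)) :=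
  (hh 0 (by simp)).tendsto.mono_left
    (nhdsWithin_le_iff.2 (mem_of_superset (Ioc_mem_nhdsGT one_pos) Ioc_subset_Icc_self))

/-! ### Bounds for solutions of the singular first-order problem. -/

namespace IsProfile

variable {q : ℝ} {h r y : ℝ → ℝ}

/-- The singular term is nonnegative, so dropping it leaves `y' ≤ h ≤ C`. -/
theorem sub_le_of_le (hy : IsProfile q h r y) (hr : ∀ s ∈ Ioo (0 : ℝ) 1, 0 < r s) {b C : ℝ}
    (hb : b ∈ Ioo (0 : ℝ) 1) (hC : ∀ s ∈ Ioo 0 b, h s ≤ C) {s : ℝ} (hs : s ∈ Icc 0 b) :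
    y s ≤ C * s := by
  have hsub : ∀ x ∈ Ioo 0 b, x ∈ Ioo (0 : ℝ) 1 := fun x hx => ⟨hx.1, hx.2.trans hb.2⟩
  have hm : MonotoneOn (fun x => C * x - y x) (Icc 0 b) := by
    refine monotoneOn_Icc_of_hasDerivAt
      (w' := fun x => C * 1 - (h x - (r x / y x) ^ q)) ?_ ?_ ?_
    · exact (continuousOn_const.mul continuousOn_id).sub
        (hy.cont.mono (Icc_subset_Icc_right hb.2.le))
    · intro x hx
      exact ((hasDerivAt_id x).const_mul C).sub (hy.deriv x (hsub x hx))
    · intro x hx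
      have := hC x hx
      have : 0 ≤ (r x / y x) ^ q :=
        Real.rpow_nonneg (div_nonneg (hr x (hsub x hx)).le (hy.pos x (hsub x hx)).le) q
      linarith
  have := hm (left_mem_Icc.2 hb.1.le) hs hs.1
  simp only [mul_zero, hy.zero, sub_zero] at this
  linarith

theorem nonneg_coeff_zero (hy : IsProfile q h r y) (hr : ∀ s ∈ Ioo (0 : ℝ) 1, 0 < r s)
    (hh : ContinuousOn h (Icc 0 1)) : 0 ≤ h 0 := by
  by_contra! hneg
  obtain ⟨η, hη, hη1, hlt⟩ := exists_Ioc_of_eventually_nhdsGT_zero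
    ((tendsto_nhdsGT_zero_of_continuousOn hh).eventually (gt_mem_nhds hneg)) one_pos
  have h1 := hy.sub_le_of_le hr (b := η) ⟨hη, hη1⟩ (fun s hs => (hlt s ⟨hs.1, hs.2.le⟩).le)
    (right_mem_Icc.2 hη.le)
  have h2 := hy.pos η ⟨hη, hη1⟩
  linarith

/-- While `y > y₀` the singular term of `y` is the smaller one, so `y - y₀` grows at least as fast
as `∫ (h - h₀)`. It is then positive at the first point where `y ≤ y₀`, a contradiction. -/
theorem not_eventually_lt {h₀ y₀ : ℝ → ℝ} (hq : 0 < q) (hr : ∀ s ∈ Ioo (0 : ℝ) 1, 0 < r s)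
    (hy : IsProfile q h r y) (hy₀ : IsProfile q h₀ r y₀) (hh : ContinuousOn h (Icc 0 1))
    (hh₀ : ContinuousOn h₀ (Icc 0 1))
    (hpos : ∀ s ∈ Ioc (0 : ℝ) 1, 0 < ∫ x in (0 : ℝ)..s, (h x - h₀ x)) :
    ¬ ∀ᶠ s in 𝓝[>] 0, y₀ s < y s := by
  intro hev
  obtain ⟨η, hη, hη1, hlt⟩ := exists_Ioc_of_eventually_nhdsGT_zero hev one_pos
  have hsub : Icc η 1 ⊆ Icc (0 : ℝ) 1 := Icc_subset_Icc_left hη.le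
  have hcl : IsClosed {s ∈ Icc η 1 | y s ≤ y₀ s} :=
    isClosed_Icc.isClosed_le (hy.cont.mono hsub) (hy₀.cont.mono hsub)
  -- Such a point exists because both profiles vanish at `1`.
  obtain ⟨s₁, ⟨hs₁, hle⟩, hmin⟩ := (isCompact_Icc.of_isClosed_subset hcl
    (fun _ h => h.1)).exists_isLeast ⟨1, right_mem_Icc.2 hη1.le, by rw [hy.one, hy₀.one]⟩
  have hs₁0 : 0 < s₁ := hη.trans_le hs₁.1
  have hlt' : ∀ s ∈ Ioo 0 s₁, y₀ s < y s := by
    intro s hs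
    rcases le_total s η with hsη | hsη
    · exact hlt s ⟨hs.1, hsη⟩
    · by_contra! hcon
      exact (hmin ⟨⟨hsη, hs.2.le.trans hs₁.2⟩, hcon⟩).not_gt hs.2
  have hc : ContinuousOn (fun x => h x - h₀ x) (Icc 0 1) := hh.sub hh₀
  have hint : IntegrableOn (fun x => h x - h₀ x) (Icc 0 1) := hc.integrableOn_Icc
  have hm : MonotoneOn (fun s => y s - y₀ s - ∫ x in (0 : ℝ)..s, (h x - h₀ x)) (Icc 0 s₁) := by
    refine monotoneOn_Icc_of_hasDerivAt (w' := fun s =>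
      h s - (r s / y s) ^ q - (h₀ s - (r s / y₀ s) ^ q) - (h s - h₀ s)) ?_ ?_ ?_
    · have := intervalIntegral.continuousOn_primitive_interval (f := fun x => h x - h₀ x)
        (μ := volume) (a := 0) (b := 1) (by rwa [uIcc_of_le zero_le_one])
      rw [uIcc_of_le zero_le_one] at this
      exact ((hy.cont.sub hy₀.cont).sub this).mono (Icc_subset_Icc_right hs₁.2)
    · intro s hs
      have hs' : s ∈ Ioo (0 : ℝ) 1 := ⟨hs.1, hs.2.trans_le hs₁.2⟩
      refine ((hy.deriv s hs').sub (hy₀.deriv s hs')).sub ?_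
      refine intervalIntegral.integral_hasDerivAt_right ?_ ?_ ?_
      · rw [intervalIntegrable_iff_integrableOn_Icc_of_le hs.1.le]
        exact hint.mono_set (Icc_subset_Icc_right hs'.2.le)
      · exact (hc.mono Ioo_subset_Icc_self).stronglyMeasurableAtFilter isOpen_Ioo s hs'
      · exact hc.continuousAt (Icc_mem_nhds hs'.1 hs'.2)
    · intro s hs
      have hs' : s ∈ Ioo (0 : ℝ) 1 := ⟨hs.1, hs.2.trans_le hs₁.2⟩
      have : (r s / y s) ^ q ≤ (r s / y₀ s) ^ q := by
        have := (hr s hs').le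
        have := (hy₀.pos s hs')
        have := (hy.pos s hs')
        have := hlt' s hs
        gcongr
      linarith
  have := hm (left_mem_Icc.2 hs₁0.le) (right_mem_Icc.2 hs₁0.le) hs₁0.le
  simp only [hy.zero, hy₀.zero, intervalIntegral.integral_same] at this
  linarith [hpos s₁ ⟨hs₁0, hs₁.2⟩]

variable {δ μ M : ℝ} {ξ : ℝ → ℝ}

/-- Where `y = k ξ`, the ratio `r / y` is at least `μ / k`; for small `k` this makes `y' < k ξ'`, so
`y` can cross `k ξ` only downwards. Being below it near `0` would therefore persist up to `b`, where
`y` is above it. -/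
theorem exists_mul_le (hq : 0 < q) (hy : IsProfile q h r y) (hh : ContinuousOn h (Icc 0 1))
    (hδ : 0 < δ) (hδ1 : δ ≤ 1) (hμ : 0 < μ) (hM : 0 < M) (hξ : ContDiffOn ℝ 1 ξ (Icc 0 δ))
    (hchain : ∀ s ∈ Ioo 0 δ, μ * ξ s ≤ r s ∧ r s ≤ M * ξ s) :
    ∃ k > 0, ∀ᶠ s in 𝓝[>] 0, k * r s ≤ y s := by
  have hu := uniqueDiffOn_Icc hδ
  obtain ⟨D, hD⟩ := isCompact_Icc.exists_bound_of_continuousOn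
    (hξ.continuousOn_derivWithin hu le_rfl)
  obtain ⟨H, hH⟩ := isCompact_Icc.exists_bound_of_continuousOn hh
  set b := δ / 2 with hb
  have hbδ : b < δ := half_lt_self hδ
  have hb0 : 0 < b := by positivity
  have hb1 : b < 1 := hbδ.trans_le hδ1
  have hD0 : 0 ≤ D := (norm_nonneg _).trans (hD 0 (left_mem_Icc.2 hδ.le))
  have e1 : ∀ᶠ k in 𝓝[>] (0 : ℝ), k * ξ b < y b := by
    have : Tendsto (fun k : ℝ => k * ξ b) (𝓝[>] 0) (𝓝 (0 * ξ b)) :=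
      ((continuous_id.mul continuous_const).tendsto 0).mono_left nhdsWithin_le_nhds
    exact this.eventually (gt_mem_nhds (by simpa using hy.pos b ⟨hb0, hb1⟩))
  have e2 : ∀ᶠ k in 𝓝[>] (0 : ℝ), H + D < (μ / k) ^ q := by
    have : Tendsto (fun k : ℝ => (μ * k⁻¹) ^ q) (𝓝[>] 0) atTop :=
      (tendsto_rpow_atTop hq).comp (tendsto_inv_nhdsGT_zero.const_mul_atTop hμ)
    simpa only [div_eq_mul_inv] using this.eventually_gt_atTop (H + D)
  -- The condition `k ≤ 1` makes `-D` a lower bound for `k ξ'` as well.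
  obtain ⟨k, ⟨⟨hk1, hk2⟩, hk0 : 0 < k⟩, hk3 : k ≤ 1⟩ := ((e1.and e2).and
    self_mem_nhdsWithin).and (mem_of_superset (Ioc_mem_nhdsGT one_pos) (fun x hx => hx.2)) |>.exists
  have key : ∀ s ∈ Ioo 0 b, k * ξ s ≤ y s := by
    intro s₀ hs₀
    by_contra! hcon
    have hin : ∀ s ∈ Icc s₀ b, s ∈ Ioo 0 δ := fun s hs =>
      ⟨hs₀.1.trans_le hs.1, hs.2.trans_lt hbδ⟩
    have hin1 : ∀ s ∈ Icc s₀ b, s ∈ Ioo (0 : ℝ) 1 := fun s hs =>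
      ⟨hs₀.1.trans_le hs.1, hs.2.trans_lt hb1⟩
    have := le_of_hasDerivAt_lt (v := y) (w := fun s => k * ξ s)
      (v' := fun s => h s - (r s / y s) ^ q) (w' := fun s => k * derivWithin ξ (Icc 0 δ) s)
      (hy.cont.mono fun s hs => Ioo_subset_Icc_self (hin1 s hs))
      (fun s hs => hy.deriv s (hin1 s (Ico_subset_Icc_self hs)))
      (continuousOn_const.mul (hξ.continuousOn.mono fun s hs => Ioo_subset_Icc_self (hin s hs)))
      (fun s hs => by
        have hs' := hin s (Ico_subset_Icc_self hs)
        exact ((hξ.differentiableOn one_ne_zero s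
          (Ioo_subset_Icc_self hs')).hasDerivWithinAt.hasDerivAt
            (Icc_mem_nhds hs'.1 hs'.2)).const_mul k) hcon.le
      (fun s hs heq => by
        have hs' := hin s (Ico_subset_Icc_self hs)
        have hs1 := hin1 s (Ico_subset_Icc_self hs)
        have h1 := hH s (Ioo_subset_Icc_self hs1)
        have h2 := hD s (Ioo_subset_Icc_self hs')
        rw [Real.norm_eq_abs] at h1 h2
        have h3 : μ / k ≤ r s / y s := by
          have hys := hy.pos s hs1
          rw [div_le_div_iff₀ hk0 hys, heq]
          nlinarith [(hchain s hs').1]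
        have h4 : (μ / k) ^ q ≤ (r s / y s) ^ q := by gcongr
        have h5 : -D ≤ k * derivWithin ξ (Icc 0 δ) s := by
          have := (abs_le.1 h2).1
          nlinarith
        have := (abs_le.1 h1).2
        linarith) b (right_mem_Icc.2 hs₀.2.le)
    linarith
  refine ⟨k / M, by positivity, ?_⟩
  filter_upwards [Ioo_mem_nhdsGT hb0] with s hs
  have h1 := (hchain s ⟨hs.1, hs.2.trans hbδ⟩).2
  calc k / M * r s ≤ k / M * (M * ξ s) := by gcongr
    _ = k * ξ s := by field_simp
    _ ≤ y s := key s hs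

/-- A positive limit gives `r ≥ κ s` near `0`, while `y ≤ H s` always holds there. -/
theorem exists_le_mul_of_pos (hq : 0 < q) (hy : IsProfile q h r y)
    (hh : ContinuousOn h (Icc 0 1)) (hr : ∀ s ∈ Ioo (0 : ℝ) 1, 0 < r s) {ℓ : ℝ} (hℓ : 0 < ℓ)
    (hlim : Tendsto (fun s => (r s / s) ^ q) (𝓝[>] 0) (𝓝 ℓ)) :
    ∃ K > 0, ∀ᶠ s in 𝓝[>] 0, y s ≤ K * r s := by
  obtain ⟨H, hH⟩ := isCompact_Icc.exists_bound_of_continuousOn hh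
  have hH0 : 0 ≤ H := (norm_nonneg _).trans (hH 0 (by simp))
  set κ := (ℓ / 2) ^ q⁻¹ with hκ
  have hκ0 : 0 < κ := by positivity
  refine ⟨(H + 1) / κ, by positivity, ?_⟩
  filter_upwards [hlim.eventually (lt_mem_nhds (half_lt_self hℓ)),
    Ioo_mem_nhdsGT (one_half_pos (α := ℝ))] with s hs hs2
  have hs1 : s ∈ Ioo (0 : ℝ) 1 := ⟨hs2.1, hs2.2.trans one_half_lt_one⟩
  have h1 : κ ≤ r s / s := by
    have hrs : 0 ≤ r s / s := div_nonneg (hr s hs1).le hs1.1.le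
    calc κ ≤ ((r s / s) ^ q) ^ q⁻¹ := by rw [hκ]; gcongr
      _ = r s / s := Real.rpow_rpow_inv hrs hq.ne'
  rw [le_div_iff₀ hs1.1] at h1
  have h2 := hy.sub_le_of_le hr (C := H) (b := 1 / 2) (by norm_num)
    (fun x hx => (le_abs_self _).trans (hH x ⟨hx.1.le, by linarith [hx.2]⟩)) (s := s)
    ⟨hs2.1.le, hs2.2.le⟩
  calc y s ≤ (H + 1) * s := by nlinarith [hs1.1]
    _ = (H + 1) / κ * (κ * s) := by field_simp
    _ ≤ (H + 1) / κ * r s := by gcongr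

/-- Since `0 < ξ ≤ r / μ`, the quotient `ξ / s` tends to `0` along with `r / s`; this forces first
`ξ 0 = 0`, then a zero slope. -/
theorem derivWithin_eq_zero_of_tendsto (hq : 0 < q) (hr : ∀ s ∈ Ioo (0 : ℝ) 1, 0 < r s)
    (hlim : Tendsto (fun s => (r s / s) ^ q) (𝓝[>] 0) (𝓝 0))
    (hδ : 0 < δ) (hδ1 : δ ≤ 1) (hμ : 0 < μ) (hM : 0 < M) (hξ : ContDiffOn ℝ 1 ξ (Icc 0 δ))
    (hchain : ∀ s ∈ Ioo 0 δ, μ * ξ s ≤ r s ∧ r s ≤ M * ξ s) :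
    derivWithin ξ (Icc 0 δ) 0 = 0 := by
  have h1 : Tendsto (fun s => r s / s) (𝓝[>] 0) (𝓝 0) := by
    have := hlim.rpow_const (p := q⁻¹) (Or.inr (by positivity))
    rw [Real.zero_rpow (by positivity)] at this
    refine this.congr' ?_
    filter_upwards [Ioo_mem_nhdsGT (one_pos (α := ℝ))] with s hs
    exact Real.rpow_rpow_inv (div_nonneg (hr s hs).le hs.1.le) hq.ne'
  have h2 : Tendsto (fun s => ξ s / s) (𝓝[>] 0) (𝓝 0) := by
    refine squeeze_zero' (g := fun s => μ⁻¹ * (r s / s)) ?_ ?_ (by simpa using h1.const_mul μ⁻¹)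
    · filter_upwards [Ioo_mem_nhdsGT hδ] with s hs
      have h3 := hr s ⟨hs.1, hs.2.trans_le hδ1⟩
      have : 0 < ξ s := pos_of_mul_pos_right (h3.trans_le (hchain s hs).2) hM.le
      exact div_nonneg this.le hs.1.le
    · filter_upwards [Ioo_mem_nhdsGT hδ] with s hs
      have hs0 := hs.1
      calc ξ s / s = μ⁻¹ * ((μ * ξ s) / s) := by field_simp
        _ ≤ μ⁻¹ * (r s / s) := by gcongr; exact (hchain s hs).1
  have hmem : (0 : ℝ) ∈ Icc 0 δ := left_mem_Icc.2 hδ.le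
  have hnh : 𝓝[>] (0 : ℝ) ≤ 𝓝[Icc 0 δ] 0 :=
    nhdsWithin_le_iff.2 (mem_of_superset (Ioc_mem_nhdsGT hδ) Ioc_subset_Icc_self)
  have h3 : ξ 0 = 0 := by
    refine tendsto_nhds_unique ((hξ.continuousOn 0 hmem).tendsto.mono_left hnh) ?_
    have : Tendsto (fun s : ℝ => s * (ξ s / s)) (𝓝[>] 0) (𝓝 (0 * 0)) :=
      (tendsto_id.mono_left nhdsWithin_le_nhds).mul h2
    rw [zero_mul] at this
    refine this.congr' ?_
    filter_upwards [self_mem_nhdsWithin] with s hs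
    have hs0 : s ≠ 0 := ne_of_gt hs
    field_simp
  have h4 := (hξ.differentiableOn one_ne_zero 0 hmem).hasDerivWithinAt
  have h5 : Tendsto (slope ξ 0) (𝓝[>] 0) (𝓝 (derivWithin ξ (Icc 0 δ) 0)) := by
    refine (hasDerivWithinAt_iff_tendsto_slope.1 h4).mono_left ?_
    refine nhdsWithin_le_iff.2 (mem_of_superset (Ioc_mem_nhdsGT hδ) ?_)
    intro s hs
    exact ⟨Ioc_subset_Icc_self hs, ne_of_gt hs.1⟩
  refine tendsto_nhds_unique h5 (h2.congr fun s => ?_)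
  rw [slope_def_field, h3, sub_zero, sub_zero]

/-- Here `ξ'` is small near `0`, so once `y` is above `k ξ` it remains above, with slope greater
than `B`. The slower profile `y₀` supplies the contradiction to this fast growth. -/
theorem exists_le_mul_of_zero {h₀ y₀ : ℝ → ℝ} (hq : 0 < q)
    (hr : ∀ s ∈ Ioo (0 : ℝ) 1, 0 < r s)
    (hy : IsProfile q h r y) (hy₀ : IsProfile q h₀ r y₀) (hh : ContinuousOn h (Icc 0 1))
    (hh₀ : ContinuousOn h₀ (Icc 0 1)) (hlt0 : h₀ 0 < h 0)
    (hpos : ∀ s ∈ Ioc (0 : ℝ) 1, 0 < ∫ x in (0 : ℝ)..s, (h x - h₀ x))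
    (hlim : Tendsto (fun s => (r s / s) ^ q) (𝓝[>] 0) (𝓝 0))
    (hδ : 0 < δ) (hδ1 : δ ≤ 1) (hμ : 0 < μ) (hM : 0 < M) (hξ : ContDiffOn ℝ 1 ξ (Icc 0 δ))
    (hchain : ∀ s ∈ Ioo 0 δ, μ * ξ s ≤ r s ∧ r s ≤ M * ξ s) :
    ∃ K > 0, ∀ᶠ s in 𝓝[>] 0, y s ≤ K * r s := by
  have hu := uniqueDiffOn_Icc hδ
  have hξ0 := derivWithin_eq_zero_of_tendsto hq hr hlim hδ hδ1 hμ hM hξ hchain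
  have hA₀ := hy₀.nonneg_coeff_zero hr hh₀
  -- The levels satisfy `0 ≤ h₀ 0 < B₀ < B < A < h 0`: `B₀` bounds the slope of `y₀`, `B` will be
  -- the slope of `y`, and `A - B` is the room for the singular term.
  obtain ⟨B₀, hB₀, hB₀'⟩ := exists_between hlt0
  obtain ⟨B, hB, hB'⟩ := exists_between hB₀'
  obtain ⟨A, hA, hA'⟩ := exists_between hB'
  have hBpos : 0 < B := by linarith
  obtain ⟨k, hk, hk0 : 0 < k⟩ : ∃ k, (M / k) ^ q < A - B ∧ 0 < k := by
    have : Tendsto (fun k : ℝ => (M / k) ^ q) atTop (𝓝 0) := by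
      have := (tendsto_const_nhds (x := M)).div_atTop (tendsto_id (α := ℝ)) |>.rpow_const
        (p := q) (Or.inr hq.le)
      rwa [Real.zero_rpow hq.ne'] at this
    exact ((this.eventually (gt_mem_nhds (sub_pos.2 hA))).and (eventually_gt_atTop 0)).exists
  have e1 : ∀ᶠ s in 𝓝[>] (0 : ℝ), k * derivWithin ξ (Icc 0 δ) s < B := by
    have hnh : 𝓝[>] (0 : ℝ) ≤ 𝓝[Icc 0 δ] 0 :=
      nhdsWithin_le_iff.2 (mem_of_superset (Ioc_mem_nhdsGT hδ) Ioc_subset_Icc_self)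
    have := (((hξ.continuousOn_derivWithin hu le_rfl) 0
      (left_mem_Icc.2 hδ.le)).tendsto.mono_left hnh).const_mul k
    rw [hξ0, mul_zero] at this
    exact this.eventually (gt_mem_nhds hBpos)
  have e2 := (tendsto_nhdsGT_zero_of_continuousOn hh).eventually (lt_mem_nhds hA')
  have e3 := (tendsto_nhdsGT_zero_of_continuousOn hh₀).eventually (gt_mem_nhds hB₀)
  obtain ⟨b, hb0, hbδ, hb⟩ := exists_Ioc_of_eventually_nhdsGT_zero ((e1.and e2).and e3) hδ
  have hb1 : b < 1 := hbδ.trans_le hδ1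
  have hξpos : ∀ s ∈ Ioo 0 δ, 0 < ξ s := fun s hs => pos_of_mul_pos_right
    ((hr s ⟨hs.1, hs.2.trans_le hδ1⟩).trans_le (hchain s hs).2) hM.le
  have hder : ∀ s ∈ Ioc 0 b, k * ξ s ≤ y s → B < h s - (r s / y s) ^ q := by
    intro s hs hle
    have hs' : s ∈ Ioo 0 δ := ⟨hs.1, hs.2.trans_lt hbδ⟩
    have hs1 : s ∈ Ioo (0 : ℝ) 1 := ⟨hs.1, hs.2.trans_lt hb1⟩
    have hrs := (hr s hs1).le
    have hys := hy.pos s hs1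
    have h1 : r s / y s ≤ M / k := by
      rw [div_le_div_iff₀ hys hk0]
      nlinarith [(hchain s hs').2]
    have h2 : (r s / y s) ^ q ≤ (M / k) ^ q := by gcongr
    linarith [(hb s hs).1.2]
  by_cases hfreq : ∃ᶠ s in 𝓝[>] 0, k * ξ s < y s
  · exfalso
    -- Points with `k ξ < y` accumulate at `0`, so one lies to the left of any given `s`, and the
    -- barrier carries the inequality from there to `s`.
    have hge : ∀ s ∈ Ioc 0 b, k * ξ s ≤ y s := by
      intro s hs
      obtain ⟨s₀, hlt, hs₀⟩ := (hfreq.and_eventually (Ioo_mem_nhdsGT hs.1)).exists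
      have hin : ∀ x ∈ Icc s₀ s, x ∈ Ioc 0 b := fun x hx =>
        ⟨hs₀.1.trans_le hx.1, hx.2.trans hs.2⟩
      have hin' : ∀ x ∈ Icc s₀ s, x ∈ Ioo 0 δ := fun x hx =>
        ⟨(hin x hx).1, (hin x hx).2.trans_lt hbδ⟩
      have hin1 : ∀ x ∈ Icc s₀ s, x ∈ Ioo (0 : ℝ) 1 := fun x hx =>
        ⟨(hin x hx).1, (hin x hx).2.trans_lt hb1⟩
      refine le_of_hasDerivAt_lt (v := fun s => k * ξ s) (w := y)
        (w' := fun s => h s - (r s / y s) ^ q) (v' := fun s => k * derivWithin ξ (Icc 0 δ) s)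
        (continuousOn_const.mul (hξ.continuousOn.mono fun x hx =>
          Ioo_subset_Icc_self (hin' x hx))) ?_
        (hy.cont.mono fun x hx => Ioo_subset_Icc_self (hin1 x hx))
        (fun x hx => hy.deriv x (hin1 x (Ico_subset_Icc_self hx))) hlt.le ?_ s
        (right_mem_Icc.2 hs₀.2.le)
      · intro x hx
        have hx' := hin' x (Ico_subset_Icc_self hx)
        exact ((hξ.differentiableOn one_ne_zero x
          (Ioo_subset_Icc_self hx')).hasDerivWithinAt.hasDerivAt
            (Icc_mem_nhds hx'.1 hx'.2)).const_mul k
      · intro x hx heq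
        have hx' := hin x (Ico_subset_Icc_self hx)
        exact (hb x hx').1.1.trans (hder x hx' heq.le)
    refine not_eventually_lt hq hr hy hy₀ hh hh₀ hpos ?_
    filter_upwards [Ioo_mem_nhdsGT hb0] with s hs
    have h1 := hy₀.sub_le_of_le hr (b := b) (C := B₀) ⟨hb0, hb1⟩
      (fun x hx => (hb x ⟨hx.1, hx.2.le⟩).2.le) (s := s) ⟨hs.1.le, hs.2.le⟩
    have hm : MonotoneOn (fun x => y x - B * x) (Icc 0 b) := by
      refine monotoneOn_Icc_of_hasDerivAt
        (w' := fun x => (h x - (r x / y x) ^ q) - B * 1) ?_ ?_ ?_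
      · exact (hy.cont.mono (Icc_subset_Icc_right hb1.le)).sub
          (continuousOn_const.mul continuousOn_id)
      · intro x hx
        exact (hy.deriv x ⟨hx.1, hx.2.trans hb1⟩).sub ((hasDerivAt_id x).const_mul B)
      · intro x hx
        have hx' : x ∈ Ioc 0 b := ⟨hx.1, hx.2.le⟩
        linarith [hder x hx' (hge x hx')]
    have h2 := hm (left_mem_Icc.2 hb0.le) ⟨hs.1.le, hs.2.le⟩ hs.1.le
    simp only [hy.zero, mul_zero, sub_zero] at h2
    nlinarith [hs.1]
  · rw [not_frequently] at hfreq
    refine ⟨k / μ, by positivity, ?_⟩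
    filter_upwards [hfreq, Ioo_mem_nhdsGT hδ] with s hs hs'
    calc y s ≤ k * ξ s := not_lt.1 hs
      _ = k / μ * (μ * ξ s) := by field_simp
      _ ≤ k / μ * r s := by gcongr; exact (hchain s hs').1

end IsProfile

/-! ### Intervals and one-sided limits with extended real endpoints. -/

theorem isOpen_realInterval (α β : EReal) : IsOpen (realInterval α β) :=
  (isOpen_Ioo (a := α) (b := β)).preimage continuous_coe_real_ereal

theorem ordConnected_realInterval (α β : EReal) : OrdConnected (realInterval α β) :=
  ⟨fun _ hx _ hy _ hz => ⟨hx.1.trans_le (EReal.coe_le_coe_iff.2 hz.1),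
    (EReal.coe_le_coe_iff.2 hz.2).trans_lt hy.2⟩⟩

theorem eventually_leftOf_iff {α β : EReal} (hαβ : α < β) {P : ℝ → Prop} :
    (∀ᶠ t in leftOf β, P t) ↔
      ∃ t₀ ∈ realInterval α β, ∀ t : ℝ, t₀ < t → (t : EReal) < β → P t := by
  constructor
  · intro h
    obtain ⟨S, hS, hSP⟩ := mem_comap.1 h
    obtain ⟨l, hl, hlS⟩ := (mem_nhdsLT_iff_exists_Ioo_subset' hαβ).1 hS
    obtain ⟨t₀, h1, h2⟩ := EReal.lt_iff_exists_real_btwn.1 (max_lt hαβ hl)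
    rw [max_lt_iff] at h1
    exact ⟨t₀, ⟨h1.1, h2⟩, fun t ht htβ =>
      hSP (hlS ⟨h1.2.trans (EReal.coe_lt_coe_iff.2 ht), htβ⟩)⟩
  · rintro ⟨t₀, ht₀, h⟩
    refine mem_comap.2 ⟨Ioo t₀ β, Ioo_mem_nhdsLT ht₀.2, fun t ht => ?_⟩
    exact h t (EReal.coe_lt_coe_iff.1 ht.1) ht.2

theorem eventually_rightOf_iff {α β : EReal} (hαβ : α < β) {P : ℝ → Prop} :
    (∀ᶠ t in rightOf α, P t) ↔
      ∃ t₀ ∈ realInterval α β, ∀ t : ℝ, t < t₀ → α < (t : EReal) → P t := by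
  constructor
  · intro h
    obtain ⟨S, hS, hSP⟩ := mem_comap.1 h
    obtain ⟨l, hl, hlS⟩ := (mem_nhdsGT_iff_exists_Ioo_subset' hαβ).1 hS
    obtain ⟨t₀, h2, h1⟩ := EReal.lt_iff_exists_real_btwn.1 (lt_min hαβ hl)
    rw [lt_min_iff] at h1
    exact ⟨t₀, ⟨h2, h1.1⟩, fun t ht htα =>
      hSP (hlS ⟨htα, (EReal.coe_lt_coe_iff.2 ht).trans h1.2⟩)⟩
  · rintro ⟨t₀, ht₀, h⟩
    refine mem_comap.2 ⟨Ioo α t₀, Ioo_mem_nhdsGT ht₀.1, fun t ht => ?_⟩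
    exact h t (EReal.coe_lt_coe_iff.1 ht.2) ht.1

theorem rightOf_neBot {α β : EReal} (hαβ : α < β) : (rightOf α).NeBot := by
  refine ⟨fun hbot => ?_⟩
  have : ∀ᶠ t in rightOf α, False := by rw [hbot]; exact eventually_bot
  obtain ⟨t₀, ht₀, h⟩ := (eventually_rightOf_iff hαβ).1 this
  obtain ⟨t, h1, h2⟩ := EReal.lt_iff_exists_real_btwn.1 ht₀.1
  exact h t (EReal.coe_lt_coe_iff.1 h2) h1

/-! ### Strict monotonicity of waves and reduction to a profile. -/

namespace IsTravelingWave

variable {p : ℝ} {d f g ρ : ℝ → ℝ} {c : ℝ} {α β : EReal} {u : ℝ → ℝ}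

theorem hasDerivAt (hu : IsTravelingWave p d f g ρ c α β u) {t : ℝ}
    (ht : t ∈ realInterval α β) : HasDerivAt u (deriv u t) t :=
  ((hu.u_C1.differentiableOn one_ne_zero t ht).differentiableAt
    ((isOpen_realInterval α β).mem_nhds ht)).hasDerivAt

theorem hasDerivAt_flux (hu : IsTravelingWave p d f g ρ c α β u) {t : ℝ}
    (ht : t ∈ realInterval α β) :
    HasDerivAt (flux p d u) (-(c * g (u t) - f (u t)) * deriv u t - ρ (u t)) t := by
  have h := ((hu.flux_C1.differentiableOn one_ne_zero t ht).differentiableAt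
    ((isOpen_realInterval α β).mem_nhds ht)).hasDerivAt
  have := hu.ode t ht
  rwa [show deriv (flux p d u) t = -(c * g (u t) - f (u t)) * deriv u t - ρ (u t) by
    linarith] at h

theorem flux_nonneg_iff (hyp : StructuralHypotheses p d f g ρ)
    (hu : IsTravelingWave p d f g ρ c α β u) {t : ℝ} (ht : t ∈ realInterval α β) :
    0 ≤ flux p d u t ↔ 0 ≤ deriv u t := by
  have hd := hyp.d_pos _ (hu.u_mem t ht)
  unfold flux
  rcases eq_or_ne (deriv u t) 0 with h | h
  · simp [h]
  · exact mul_nonneg_iff_of_pos_left (mul_pos hd (Real.rpow_pos_of_pos (abs_pos.2 h) _))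

/-- At a critical point the equation gives `flux' = -ρ(u) < 0`, so a vanishing flux is positive just
to the left. -/
theorem exists_flux_pos_of_nonneg (hyp : StructuralHypotheses p d f g ρ)
    (hu : IsTravelingWave p d f g ρ c α β u) {t : ℝ} (ht : t ∈ realInterval α β)
    (h0 : 0 ≤ flux p d u t) : ∃ t' ∈ realInterval α β, 0 < flux p d u t' := by
  rcases h0.lt_or_eq with h | h
  · exact ⟨t, ht, h⟩
  have hd0 : deriv u t = 0 := by
    by_contra hne
    have := hyp.d_pos _ (hu.u_mem t ht)
    exact mul_ne_zero (mul_ne_zero this.ne'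
      (Real.rpow_pos_of_pos (abs_pos.2 hne) (p - 2)).ne') hne h.symm
  have hder := hu.hasDerivAt_flux ht
  rw [hd0, mul_zero, zero_sub] at hder
  have hneg : -ρ (u t) < 0 := neg_lt_zero.2 (hyp.ρ_pos _ (hu.u_mem t ht))
  have hsl := (hasDerivAt_iff_tendsto_slope.1 hder).mono_left
    (nhdsWithin_mono t (fun x (hx : x < t) => hx.ne) : 𝓝[<] t ≤ 𝓝[≠] t)
  obtain ⟨t', ⟨hs, hlt : t' < t⟩, hmem⟩ := ((hsl.eventually (gt_mem_nhds hneg)).and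
    self_mem_nhdsWithin |>.and
      (nhdsWithin_le_nhds ((isOpen_realInterval α β).mem_nhds ht))).exists
  refine ⟨t', hmem, ?_⟩
  rw [slope_def_field, ← h, sub_zero] at hs
  by_contra! hcon
  exact hs.not_ge (div_nonneg_of_nonpos hcon (sub_neg.2 hlt).le)

/-- The flux decreases strictly through each of its zeros, so a positive value at `t₀` forces it to
be nonnegative everywhere to the left. Then `u ≤ u t₀ < 1` there, contradicting `u → 1` at `α`. -/
theorem deriv_neg (hyp : StructuralHypotheses p d f g ρ)
    (hu : IsTravelingWave p d f g ρ c α β u) {t : ℝ} (ht : t ∈ realInterval α β) :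
    deriv u t < 0 := by
  by_contra! hge
  obtain ⟨t₀, ht₀, hpos⟩ := hu.exists_flux_pos_of_nonneg hyp ht
    ((hu.flux_nonneg_iff hyp ht).2 hge)
  have hoc := ordConnected_realInterval α β
  have hall : ∀ x ∈ realInterval α β, x ≤ t₀ → 0 ≤ deriv u x := by
    intro x hx hxt
    rw [← hu.flux_nonneg_iff hyp hx]
    by_contra! hneg
    have hsub : Icc x t₀ ⊆ realInterval α β := hoc.out hx ht₀
    have := image_le_of_deriv_right_lt_deriv_boundary' (f := flux p d u) (B := fun _ => 0)
      (B' := fun _ => 0) (hu.flux_C1.continuousOn.mono hsub)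
      (fun s hs => (hu.hasDerivAt_flux (hsub (Ico_subset_Icc_self hs))).hasDerivWithinAt)
      hneg.le continuousOn_const (fun s _ => hasDerivWithinAt_const _ _ _)
      (fun s hs heq => by
        have hs' := hsub (Ico_subset_Icc_self hs)
        have hds : deriv u s = 0 := by
          by_contra hne
          have := hyp.d_pos _ (hu.u_mem s hs')
          exact mul_ne_zero (mul_ne_zero this.ne'
            (Real.rpow_pos_of_pos (abs_pos.2 hne) (p - 2)).ne') hne heq
        rw [hds, mul_zero, zero_sub]
        exact neg_lt_zero.2 (hyp.ρ_pos _ (hu.u_mem s hs'))) (right_mem_Icc.2 hxt)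
    exact this.not_gt hpos
  have hle : ∀ x ∈ realInterval α β, x ≤ t₀ → u x ≤ u t₀ := by
    intro x hx hxt
    have hsub : Icc x t₀ ⊆ realInterval α β := hoc.out hx ht₀
    have hm : MonotoneOn u (Icc x t₀) := by
      refine monotoneOn_of_deriv_nonneg (convex_Icc _ _) (hu.u_C1.continuousOn.mono hsub) ?_ ?_
      · rw [interior_Icc]
        exact fun s hs => (hu.hasDerivAt
          (hsub (Ioo_subset_Icc_self hs))).differentiableAt.differentiableWithinAt
      · rw [interior_Icc]
        exact fun s hs => hall s (hsub (Ioo_subset_Icc_self hs)) hs.2.le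
    exact hm (left_mem_Icc.2 hxt) (right_mem_Icc.2 hxt) hxt
  have := rightOf_neBot hu.lt
  have hlim : 1 ≤ u t₀ := by
    refine le_of_tendsto hu.u_left ((eventually_rightOf_iff hu.lt).2 ⟨t₀, ht₀, ?_⟩)
    exact fun x hx hxα => hle x ⟨hxα, (EReal.coe_lt_coe_iff.2 hx).trans ht₀.2⟩ hx.le
  exact hlim.not_gt (hu.u_mem t₀ ht₀).2

theorem strictAntiOn (hyp : StructuralHypotheses p d f g ρ)
    (hu : IsTravelingWave p d f g ρ c α β u) : StrictAntiOn u (realInterval α β) := by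
  refine strictAntiOn_of_deriv_neg (ordConnected_realInterval α β).convex
    hu.u_C1.continuousOn fun x hx => ?_
  exact hu.deriv_neg hyp (interior_subset hx)

theorem surjOn (hu : IsTravelingWave p d f g ρ c α β u) :
    SurjOn u (realInterval α β) (Ioo 0 1) := by
  intro s hs
  have hoc := ordConnected_realInterval α β
  obtain ⟨t₁, ht₁, h1⟩ := (eventually_leftOf_iff hu.lt).1
    (hu.u_right.eventually (gt_mem_nhds hs.1))
  obtain ⟨t₀, ht₀, h0⟩ := (eventually_rightOf_iff hu.lt).1
    (hu.u_left.eventually (lt_mem_nhds hs.2))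
  obtain ⟨b, hb, hb'⟩ := EReal.lt_iff_exists_real_btwn.1 ht₁.2
  obtain ⟨a, ha, ha'⟩ := EReal.lt_iff_exists_real_btwn.1 ht₀.1
  have hbI : b ∈ realInterval α β := ⟨ht₁.1.trans hb, hb'⟩
  have haI : a ∈ realInterval α β := ⟨ha, ha'.trans ht₀.2⟩
  have hub := h1 b (EReal.coe_lt_coe_iff.1 hb) hb'
  have hua := h0 a (EReal.coe_lt_coe_iff.1 ha') ha
  exact hoc.isPreconnected.intermediate_value hbI haI hu.u_C1.continuousOn ⟨hub.le, hua.le⟩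

theorem flux_eq (hyp : StructuralHypotheses p d f g ρ)
    (hu : IsTravelingWave p d f g ρ c α β u) {t : ℝ} (ht : t ∈ realInterval α β) :
    flux p d u t = -(d (u t) * (-deriv u t) ^ (p - 1)) := by
  have hneg := hu.deriv_neg hyp ht
  unfold flux
  rw [abs_of_neg hneg, show p - 1 = (p - 2) + 1 by ring,
    Real.rpow_add_one (neg_pos.2 hneg).ne']
  ring

theorem neg_deriv_eq (hyp : StructuralHypotheses p d f g ρ)
    (hu : IsTravelingWave p d f g ρ c α β u) {t : ℝ} (ht : t ∈ realInterval α β) :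
    -deriv u t = (-flux p d u t / d (u t)) ^ (1 / (p - 1)) := by
  have hneg := hu.deriv_neg hyp ht
  have hd := hyp.d_pos _ (hu.u_mem t ht)
  rw [hu.flux_eq hyp ht, neg_neg, mul_div_cancel_left₀ _ hd.ne', one_div,
    Real.rpow_rpow_inv (neg_pos.2 hneg).le (sub_pos.2 hyp.one_lt_p).ne']

/-- A travelling wave, written as a function of its own height, is a profile. -/
theorem exists_isProfile (hyp : StructuralHypotheses p d f g ρ)
    (hu : IsTravelingWave p d f g ρ c α β u) :
    ∃ y, IsProfile (1 / (p - 1)) (fun s => c * g s - f s) (fun s => d s * ρ s ^ (p - 1)) y ∧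
      ∀ t ∈ realInterval α β, -deriv u t = (y (u t) / d (u t)) ^ (1 / (p - 1)) := by
  have hoc := ordConnected_realInterval α β
  have hanti := hu.strictAntiOn hyp
  have hp : 0 < p - 1 := sub_pos.2 hyp.one_lt_p
  set T := Function.invFunOn u (realInterval α β) with hT
  have hTmem : ∀ s ∈ Ioo (0 : ℝ) 1, T s ∈ realInterval α β := hu.surjOn.mapsTo_invFunOn
  have huT : ∀ s ∈ Ioo (0 : ℝ) 1, u (T s) = s := hu.surjOn.rightInvOn_invFunOn
  have hTu : ∀ t ∈ realInterval α β, T (u t) = t := fun t ht =>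
    hanti.injOn (hTmem _ (hu.u_mem t ht)) ht (huT _ (hu.u_mem t ht))
  have hTlt : ∀ s ∈ Ioo (0 : ℝ) 1, ∀ t ∈ realInterval α β, s < u t → t < T s := by
    intro s hs t ht hst
    rwa [← hanti.lt_iff_gt (hTmem s hs) ht, huT s hs]
  have hltT : ∀ s ∈ Ioo (0 : ℝ) 1, ∀ t ∈ realInterval α β, u t < s → T s < t := by
    intro s hs t ht hst
    rwa [← hanti.lt_iff_gt ht (hTmem s hs), huT s hs]
  have hTcont : ∀ s ∈ Ioo (0 : ℝ) 1, ContinuousAt T s := by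
    intro s hs
    have hI := (isOpen_realInterval α β).mem_nhds (hTmem s hs)
    refine tendsto_order.2 ⟨fun a ha => ?_, fun b hb => ?_⟩
    · obtain ⟨a', ⟨h1, h2⟩, h3⟩ := ((Ioo_mem_nhdsLT ha : Ioo a (T s) ∈ 𝓝[<] (T s)) |>
        fun h => (eventually_of_mem h fun _ hx => hx).and
          (nhdsWithin_le_nhds (s := Iio (T s)) hI)).exists
      have h4 : s < u a' := by
        have := hanti h3 (hTmem s hs) h2
        rwa [huT s hs] at this
      filter_upwards [gt_mem_nhds h4, Ioo_mem_nhds hs.1 hs.2] with x hx hx'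
      exact h1.trans (hTlt x hx' a' h3 hx)
    · obtain ⟨b', ⟨h1, h2⟩, h3⟩ := ((Ioo_mem_nhdsGT hb : Ioo (T s) b ∈ 𝓝[>] (T s)) |>
        fun h => (eventually_of_mem h fun _ hx => hx).and
          (nhdsWithin_le_nhds (s := Ioi (T s)) hI)).exists
      have h4 : u b' < s := by
        have := hanti (hTmem s hs) h3 h1
        rwa [huT s hs] at this
      filter_upwards [lt_mem_nhds h4, Ioo_mem_nhds hs.1 hs.2] with x hx hx'
      exact (hltT x hx' b' h3 hx).trans h2
  have hTder : ∀ s ∈ Ioo (0 : ℝ) 1, HasDerivAt T (deriv u (T s))⁻¹ s := by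
    intro s hs
    refine HasDerivAt.of_local_left_inverse (hTcont s hs) (hu.hasDerivAt (hTmem s hs))
      (hu.deriv_neg hyp (hTmem s hs)).ne ?_
    filter_upwards [Ioo_mem_nhds hs.1 hs.2] with x hx using huT x hx
  -- Outside `(0, 1)` the inverse `T` is meaningless; the value `0` is the limit of the flux at both
  -- ends, which makes `y` continuous on `[0, 1]`.
  set y : ℝ → ℝ := fun s => if s ∈ Ioo (0 : ℝ) 1 then -flux p d u (T s) else 0 with hy
  have hyT : ∀ s ∈ Ioo (0 : ℝ) 1, y s = -flux p d u (T s) := fun s hs => if_pos hs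
  have hypos : ∀ s ∈ Ioo (0 : ℝ) 1, 0 < y s := by
    intro s hs
    rw [hyT s hs, hu.flux_eq hyp (hTmem s hs), neg_neg, huT s hs]
    exact mul_pos (hyp.d_pos s hs)
      (Real.rpow_pos_of_pos (neg_pos.2 (hu.deriv_neg hyp (hTmem s hs))) _)
  have hyder : ∀ s ∈ Ioo (0 : ℝ) 1,
      HasDerivAt y (c * g s - f s - (d s * ρ s ^ (p - 1) / y s) ^ (1 / (p - 1))) s := by
    intro s hs
    have hneg := hu.deriv_neg hyp (hTmem s hs)
    have h1 := ((hu.hasDerivAt_flux (hTmem s hs)).comp s (hTder s hs)).neg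
    have hd := hyp.d_pos s hs
    have hρ := hyp.ρ_pos s hs
    -- The factor `d` cancels and the exponents `p - 1` and `1 / (p - 1)` undo each other, leaving
    -- exactly the reaction term of `d(flux)/ds`.
    have h2 : (d s * ρ s ^ (p - 1) / y s) ^ (1 / (p - 1)) = ρ s / (-deriv u (T s)) := by
      rw [hyT s hs, hu.flux_eq hyp (hTmem s hs), neg_neg, huT s hs,
        mul_div_mul_left _ _ hd.ne', ← Real.div_rpow hρ.le (neg_pos.2 hneg).le, one_div,
        Real.rpow_rpow_inv (div_pos hρ (neg_pos.2 hneg)).le hp.ne']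
    rw [h2]
    refine (h1.congr_of_eventuallyEq ?_).congr_deriv ?_
    · filter_upwards [Ioo_mem_nhds hs.1 hs.2] with x hx using hyT x hx
    · rw [huT s hs]
      have := hneg.ne
      field_simp
      ring
  have hzero : Tendsto y (𝓝[>] 0) (𝓝 0) := by
    refine (tendsto_order.2 ⟨fun a ha => ?_, fun a ha => ?_⟩)
    · filter_upwards [Ioo_mem_nhdsGT (one_pos (α := ℝ))] with s hs
      exact ha.trans (hypos s hs)
    · obtain ⟨t₀, ht₀, h⟩ := (eventually_leftOf_iff hu.lt).1
        (hu.flux_right.eventually (lt_mem_nhds (neg_lt_zero.2 ha)))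
      filter_upwards [Ioo_mem_nhdsGT (hu.u_mem t₀ ht₀).1] with s hs
      have hs1 : s ∈ Ioo (0 : ℝ) 1 := ⟨hs.1, hs.2.trans (hu.u_mem t₀ ht₀).2⟩
      rw [hyT s hs1]
      linarith [h (T s) (hTlt s hs1 t₀ ht₀ hs.2) (hTmem s hs1).2]
  have hone : Tendsto y (𝓝[<] 1) (𝓝 0) := by
    refine (tendsto_order.2 ⟨fun a ha => ?_, fun a ha => ?_⟩)
    · filter_upwards [Ioo_mem_nhdsLT (one_pos (α := ℝ))] with s hs
      exact ha.trans (hypos s hs)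
    · obtain ⟨t₀, ht₀, h⟩ := (eventually_rightOf_iff hu.lt).1
        (hu.flux_left.eventually (lt_mem_nhds (neg_lt_zero.2 ha)))
      filter_upwards [Ioo_mem_nhdsLT (hu.u_mem t₀ ht₀).2] with s hs
      have hs1 : s ∈ Ioo (0 : ℝ) 1 := ⟨(hu.u_mem t₀ ht₀).1.trans hs.1, hs.2⟩
      rw [hyT s hs1]
      linarith [h (T s) (hltT s hs1 t₀ ht₀ hs.1) (hTmem s hs1).1]
  have hy0 : y 0 = 0 := by simp [hy]
  have hy1 : y 1 = 0 := by simp [hy]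
  refine ⟨y, ⟨?_, hy0, hy1, hypos, hyder⟩, ?_⟩
  · intro s hs
    rcases hs.1.eq_or_lt with rfl | h0
    · refine ContinuousWithinAt.mono ?_ Icc_subset_Ici_self
      rw [← continuousWithinAt_Ioi_iff_Ici]
      simpa [ContinuousWithinAt, hy0] using hzero
    rcases hs.2.eq_or_lt with rfl | h1
    · refine ContinuousWithinAt.mono ?_ Icc_subset_Iic_self
      rw [← continuousWithinAt_Iio_iff_Iic]
      simpa [ContinuousWithinAt, hy1] using hone
    · exact (hyder s ⟨h0, h1⟩).continuousAt.continuousWithinAt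
  · intro t ht
    rw [hyT _ (hu.u_mem t ht), hTu t ht, hu.neg_deriv_eq hyp ht]

end IsTravelingWave

/-! ### Length of the final interval, divergence at `0`, and extension by zero. -/

theorem nhdsLT_le_leftOf (b : ℝ) : 𝓝[<] b ≤ leftOf (b : EReal) := by
  refine tendsto_iff_comap.1 (tendsto_nhdsWithin_iff.2 ⟨?_, ?_⟩)
  · exact (continuous_coe_real_ereal.tendsto b).mono_left nhdsWithin_le_nhds
  · filter_upwards [self_mem_nhdsWithin] with t ht
    exact EReal.coe_lt_coe_iff.2 ht

theorem volume_realInterval_coe_eq_top_iff {t₀ : ℝ} {β : EReal} (h : (t₀ : EReal) < β) :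
    volume (realInterval t₀ β) = ⊤ ↔ β = ⊤ := by
  induction β with
  | bot => exact absurd h not_lt_bot
  | top =>
    have : realInterval t₀ ⊤ = Ioi t₀ := by
      ext t
      simp [realInterval, EReal.coe_lt_top]
    simp [this]
  | coe b =>
    have : realInterval t₀ b = Ioo t₀ b := by
      ext t
      simp [realInterval]
    simp [this]

theorem lintegral_Ioo_zero_eq_top_mono {w : ℝ → ℝ} (hw : ContinuousOn w (Ioo 0 1)) {a b : ℝ}
    (ha : a ∈ Ioo (0 : ℝ) 1) (hb : b ∈ Ioo (0 : ℝ) 1)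
    (h : ∫⁻ s in Ioo 0 b, ENNReal.ofReal (w s) = ⊤) :
    ∫⁻ s in Ioo 0 a, ENNReal.ofReal (w s) = ⊤ := by
  by_contra hne
  have hsub : Icc a b ⊆ Ioo 0 1 := fun x hx => ⟨ha.1.trans_le hx.1, hx.2.trans_lt hb.2⟩
  have hfin : ∫⁻ s in Icc a b, ENNReal.ofReal (w s) < ⊤ :=
    ((hw.mono hsub).integrableOn_compact isCompact_Icc).lintegral_lt_top
  have hle : ∫⁻ s in Ioo 0 b, ENNReal.ofReal (w s) ≤
      (∫⁻ s in Ioo 0 a, ENNReal.ofReal (w s)) + ∫⁻ s in Icc a b, ENNReal.ofReal (w s) := by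
    refine (lintegral_mono_set fun x hx => ?_).trans (lintegral_union_le _ _ _)
    rcases lt_or_ge x a with hxa | hxa
    · exact Or.inl ⟨hx.1, hxa⟩
    · exact Or.inr ⟨hxa, hx.2.le⟩
  rw [h, top_le_iff] at hle
  exact (ENNReal.add_lt_top.2 ⟨lt_top_iff_ne_top.2 hne, hfin⟩).ne hle

/-- At `b` the left derivative is the limit of `deriv u`, hence `0`, and it matches the right
derivative of the constant. -/
theorem contDiffOn_zeroExtension {α : EReal} {b : ℝ} {u : ℝ → ℝ} (hαb : α < b)
    (hu : ContDiffOn ℝ 1 u (realInterval α b)) (hlim : Tendsto u (leftOf b) (𝓝 0))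
    (hlim' : Tendsto (deriv u) (leftOf b) (𝓝 0)) :
    ContDiffOn ℝ 1 (zeroExtension b u) {t : ℝ | α < (t : EReal)} := by
  have hopen : IsOpen {t : ℝ | α < (t : EReal)} := isOpen_Ioi.preimage continuous_coe_real_ereal
  have hI := isOpen_realInterval α b
  have hv1 : ∀ t < b, zeroExtension b u t = u t := fun t ht => by
    simp [zeroExtension, ht]
  have hv2 : ∀ t, b ≤ t → zeroExtension b u t = 0 := fun t ht => by
    simp [zeroExtension, ht]
  set w : ℝ → ℝ := fun t => if t < b then deriv u t else 0 with hw
  have hev : ∀ t < b, zeroExtension b u =ᶠ[𝓝 t] u := fun t ht => by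
    filter_upwards [gt_mem_nhds ht] with x hx using hv1 x hx
  have hIleft : realInterval α b ∈ 𝓝[<] b := by
    refine nhdsLT_le_leftOf b ((eventually_leftOf_iff hαb).2 ?_)
    obtain ⟨t₀, h1, h2⟩ := EReal.lt_iff_exists_real_btwn.1 hαb
    exact ⟨t₀, ⟨h1, h2⟩, fun t ht htb => ⟨h1.trans (EReal.coe_lt_coe_iff.2 ht), htb⟩⟩
  have hderL : ∀ t ∈ realInterval α b, HasDerivAt (zeroExtension b u) (deriv u t) t := by
    intro t ht
    exact ((hu.differentiableOn one_ne_zero t ht).differentiableAt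
      (hI.mem_nhds ht)).hasDerivAt.congr_of_eventuallyEq (hev t (EReal.coe_lt_coe_iff.1 ht.2))
  have hder : ∀ t : ℝ, α < (t : EReal) → HasDerivAt (zeroExtension b u) (w t) t := by
    intro t ht
    rcases lt_trichotomy t b with htb | rfl | htb
    · simpa [hw, htb] using hderL t ⟨ht, EReal.coe_lt_coe_iff.2 htb⟩
    · have hwt : w t = 0 := by simp [hw]
      rw [hwt]
      have h1 : HasDerivWithinAt (zeroExtension t u) 0 (Iic t) t := by
        refine hasDerivWithinAt_Iic_of_tendsto_deriv (s := realInterval α t)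
          (fun x hx => (hderL x hx).differentiableAt.differentiableWithinAt) ?_ hIleft ?_
        · have : Tendsto (zeroExtension t u) (𝓝[<] t) (𝓝 (zeroExtension t u t)) := by
            rw [hv2 t le_rfl]
            refine (hlim.mono_left (nhdsLT_le_leftOf t)).congr' ?_
            filter_upwards [self_mem_nhdsWithin] with x hx using (hv1 x hx).symm
          exact this.mono_left (nhdsWithin_mono _ fun x hx => EReal.coe_lt_coe_iff.1 hx.2)
        · refine (hlim'.mono_left (nhdsLT_le_leftOf t)).congr' ?_
          filter_upwards [hIleft] with x hx using (hderL x hx).deriv.symm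
      have h2 : HasDerivWithinAt (zeroExtension t u) 0 (Ici t) t :=
        (hasDerivWithinAt_const t (Ici t) (0 : ℝ)).congr (fun x hx => hv2 x hx) (hv2 t le_rfl)
      have := h1.union h2
      rwa [Iic_union_Ici, hasDerivWithinAt_univ] at this
    · have hwt : w t = 0 := by simp [hw, htb.le]
      rw [hwt]
      refine (hasDerivAt_const t (0 : ℝ)).congr_of_eventuallyEq ?_
      filter_upwards [lt_mem_nhds htb] with x hx using hv2 x hx.le
  have hwcont : ∀ t : ℝ, α < (t : EReal) → ContinuousAt w t := by
    intro t ht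
    rcases lt_trichotomy t b with htb | rfl | htb
    · have ht' : t ∈ realInterval α b := ⟨ht, EReal.coe_lt_coe_iff.2 htb⟩
      refine ((hu.continuousOn_deriv_of_isOpen hI le_rfl).continuousAt
        (hI.mem_nhds ht')).congr ?_
      filter_upwards [gt_mem_nhds htb] with x hx
      simp [hw, hx]
    · have hwt : w t = 0 := by simp [hw]
      rw [continuousAt_iff_continuous_left'_right']
      constructor
      · rw [ContinuousWithinAt, hwt]
        refine (hlim'.mono_left (nhdsLT_le_leftOf t)).congr' ?_
        filter_upwards [self_mem_nhdsWithin] with x (hx : x < t)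
        simp [hw, hx]
      · rw [ContinuousWithinAt, hwt]
        refine tendsto_const_nhds.congr' ?_
        filter_upwards [self_mem_nhdsWithin] with x (hx : t < x)
        simp [hw, hx.le]
    · refine continuousAt_const.congr (f := fun _ => (0 : ℝ)) ?_
      filter_upwards [lt_mem_nhds htb] with x hx
      simp [hw, hx.le]
  have hsucc := contDiffOn_succ_iff_deriv_of_isOpen (𝕜 := ℝ) (n := 0)
    (f := zeroExtension b u) hopen
  rw [zero_add] at hsucc
  refine hsucc.2 ⟨fun t ht => (hder t ht).differentiableAt.differentiableWithinAt, by simp, ?_⟩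
  rw [contDiffOn_zero]
  intro t ht
  exact (hwcont t ht).continuousWithinAt.congr (fun x hx => (hder x hx).deriv) (hder t ht).deriv

/-! ### Behaviour of the wave at the front. -/

namespace IsTravelingWave

variable {p : ℝ} {d f g ρ : ℝ → ℝ} {c : ℝ} {α β : EReal} {u : ℝ → ℝ}

theorem tendsto_nhdsGT (hu : IsTravelingWave p d f g ρ c α β u) :
    Tendsto u (leftOf β) (𝓝[>] 0) := by
  refine tendsto_nhdsWithin_iff.2 ⟨hu.u_right, ?_⟩
  obtain ⟨t₀, h1, h2⟩ := EReal.lt_iff_exists_real_btwn.1 hu.lt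
  exact (eventually_leftOf_iff hu.lt).2 ⟨t₀, ⟨h1, h2⟩, fun t ht htβ =>
    (hu.u_mem t ⟨h1.trans (EReal.coe_lt_coe_iff.2 ht), htβ⟩).1⟩

theorem image_eq (hyp : StructuralHypotheses p d f g ρ)
    (hu : IsTravelingWave p d f g ρ c α β u) {t₀ : ℝ} (ht₀ : t₀ ∈ realInterval α β) :
    u '' realInterval t₀ β = Ioo 0 (u t₀) := by
  have hanti := hu.strictAntiOn hyp
  ext s
  constructor
  · rintro ⟨t, ht, rfl⟩
    have ht' : t ∈ realInterval α β := ⟨ht₀.1.trans ht.1, ht.2⟩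
    exact ⟨(hu.u_mem t ht').1, hanti ht₀ ht' (EReal.coe_lt_coe_iff.1 ht.1)⟩
  · intro hs
    obtain ⟨t, ht, rfl⟩ := hu.surjOn ⟨hs.1, hs.2.trans (hu.u_mem t₀ ht₀).2⟩
    exact ⟨t, ⟨EReal.coe_lt_coe_iff.2 ((hanti.lt_iff_gt ht ht₀).1 hs.2), ht.2⟩, rfl⟩

theorem lintegral_one_div_eq (hyp : StructuralHypotheses p d f g ρ)
    (hu : IsTravelingWave p d f g ρ c α β u) {t₀ : ℝ} (ht₀ : t₀ ∈ realInterval α β) :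
    ∫⁻ s in Ioo 0 (u t₀), ENNReal.ofReal (1 / ρ s) =
      ∫⁻ t in realInterval t₀ β, ENNReal.ofReal (-deriv u t / ρ (u t)) := by
  have hsub : realInterval t₀ β ⊆ realInterval α β := fun t ht => ⟨ht₀.1.trans ht.1, ht.2⟩
  have hmeas : MeasurableSet (realInterval t₀ β) := (isOpen_realInterval _ _).measurableSet
  rw [← hu.image_eq hyp ht₀, lintegral_image_eq_lintegral_abs_deriv_mul hmeas
    (fun t ht => (hu.hasDerivAt (hsub ht)).hasDerivWithinAt)
    ((hu.strictAntiOn hyp).injOn.mono hsub)]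
  refine setLIntegral_congr_fun hmeas fun t ht => ?_
  rw [← ENNReal.ofReal_mul (abs_nonneg _), abs_of_neg (hu.deriv_neg hyp (hsub ht)), mul_one_div]

/-- After the substitution `s = u t` the integrand is `-u' / ρ(u)`, which lies between `k` and `K`;
the integral is thus infinite exactly when the time interval has infinite length. -/
theorem top_iff_lintegral_eq_top (hyp : StructuralHypotheses p d f g ρ)
    (hu : IsTravelingWave p d f g ρ c α β u) {k K : ℝ} (hk : 0 < k)
    (h : ∀ᶠ t in leftOf β, k * ρ (u t) ≤ -deriv u t ∧ -deriv u t ≤ K * ρ (u t)) :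
    β = ⊤ ↔ ∫⁻ s in Ioo (0 : ℝ) (1 / 2), ENNReal.ofReal (1 / ρ s) = ⊤ := by
  obtain ⟨t₀, ht₀, hbd⟩ := (eventually_leftOf_iff hu.lt).1 h
  have hmeas : MeasurableSet (realInterval t₀ β) := (isOpen_realInterval _ _).measurableSet
  have hcont : ContinuousOn (fun s => 1 / ρ s) (Ioo 0 1) :=
    continuousOn_const.div (hyp.ρ_cont.mono Ioo_subset_Icc_self) fun s hs => (hyp.ρ_pos s hs).ne'
  have hhalf : (1 / 2 : ℝ) ∈ Ioo (0 : ℝ) 1 := by norm_num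
  have hut := hu.u_mem t₀ ht₀
  have hρ : ∀ t ∈ realInterval t₀ β, 0 < ρ (u t) := fun t ht =>
    hyp.ρ_pos _ (hu.u_mem t ⟨ht₀.1.trans ht.1, ht.2⟩)
  -- Only the behaviour at `0` matters, since `1 / ρ` is continuous on compact subintervals of `(0,
  -- 1)`; the endpoint `1 / 2` may be replaced by `u t₀`.
  rw [show ∫⁻ s in Ioo (0 : ℝ) (1 / 2), ENNReal.ofReal (1 / ρ s) = ⊤ ↔
      ∫⁻ s in Ioo 0 (u t₀), ENNReal.ofReal (1 / ρ s) = ⊤ from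
      ⟨lintegral_Ioo_zero_eq_top_mono hcont hut hhalf,
        lintegral_Ioo_zero_eq_top_mono hcont hhalf hut⟩,
    hu.lintegral_one_div_eq hyp ht₀, ← volume_realInterval_coe_eq_top_iff ht₀.2]
  have hlow : ENNReal.ofReal k * volume (realInterval t₀ β) ≤
      ∫⁻ t in realInterval t₀ β, ENNReal.ofReal (-deriv u t / ρ (u t)) := by
    rw [← setLIntegral_const]
    refine setLIntegral_mono' hmeas fun t ht => ENNReal.ofReal_le_ofReal ?_
    rw [le_div_iff₀ (hρ t ht)]
    exact (hbd t (EReal.coe_lt_coe_iff.1 ht.1) ht.2).1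
  have hup : ∫⁻ t in realInterval t₀ β, ENNReal.ofReal (-deriv u t / ρ (u t)) ≤
      ENNReal.ofReal K * volume (realInterval t₀ β) := by
    rw [← setLIntegral_const]
    refine setLIntegral_mono' hmeas fun t ht => ENNReal.ofReal_le_ofReal ?_
    rw [div_le_iff₀ (hρ t ht)]
    exact (hbd t (EReal.coe_lt_coe_iff.1 ht.1) ht.2).2
  constructor
  · intro htop
    rwa [htop, ENNReal.mul_top (ENNReal.ofReal_pos.2 hk).ne', top_le_iff] at hlow
  · intro htop
    rw [htop, top_le_iff] at hup
    by_contra hne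
    exact ENNReal.mul_ne_top ENNReal.ofReal_ne_top hne hup

/-- Near the front, the slope of a wave faster than some other wave is comparable to `ρ`. -/
theorem exists_slope_bounds (hyp : StructuralHypotheses p d f g ρ) {ℓ₀ : ℝ}
    (hℓ₀ : Tendsto (fun s : ℝ => ρ s * (d s ^ (1 / (p - 1)) / s ^ (1 / (p - 1)))) (𝓝[>] 0)
      (𝓝 ℓ₀))
    (hu : IsTravelingWave p d f g ρ c α β u) {c₀ : ℝ} (hc₀ : c₀ ∈ admissibleSpeeds p d f g ρ)
    (hlt : c₀ < c) {δ μ M : ℝ} (hδ : 0 < δ) (hμ : 0 < μ) (hM : 0 < M) {ξ : ℝ → ℝ}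
    (hξ : ContDiffOn ℝ 1 ξ (Icc 0 δ))
    (hchain : ∀ s ∈ Ioo (0 : ℝ) δ,
      μ * ξ s ≤ d s * ρ s ^ (p - 1) ∧ d s * ρ s ^ (p - 1) ≤ M * ξ s) :
    ∃ k > 0, ∃ K > 0, ∀ᶠ t in leftOf β,
      k * ρ (u t) ≤ -deriv u t ∧ -deriv u t ≤ K * ρ (u t) := by
  have hp : 0 < p - 1 := sub_pos.2 hyp.one_lt_p
  have hq : 0 < 1 / (p - 1) := one_div_pos.2 hp
  obtain ⟨y, hy, hyu⟩ := hu.exists_isProfile hyp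
  obtain ⟨α₀, β₀, u₀, hu₀⟩ := hc₀
  obtain ⟨y₀, hy₀, -⟩ := hu₀.exists_isProfile hyp
  have hr : ∀ s ∈ Ioo (0 : ℝ) 1, 0 < d s * ρ s ^ (p - 1) := fun s hs =>
    mul_pos (hyp.d_pos s hs) (Real.rpow_pos_of_pos (hyp.ρ_pos s hs) _)
  have hcont : ∀ c : ℝ, ContinuousOn (fun s => c * g s - f s) (Icc 0 1) := fun c =>
    (continuousOn_const.mul hyp.g_cont).sub hyp.f_cont
  have hlt0 : c₀ * g 0 - f 0 < c * g 0 - f 0 := by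
    have := mul_lt_mul_of_pos_right hlt hyp.g_zero_pos
    linarith
  have hpos : ∀ s ∈ Ioc (0 : ℝ) 1,
      0 < ∫ x in (0 : ℝ)..s, (c * g x - f x - (c₀ * g x - f x)) := by
    intro s hs
    have : ∀ x, c * g x - f x - (c₀ * g x - f x) = (c - c₀) * g x := fun x => by ring
    simp only [this, intervalIntegral.integral_const_mul]
    exact mul_pos (sub_pos.2 hlt) (hyp.g_integral_pos s hs)
  have hlim : Tendsto (fun s => (d s * ρ s ^ (p - 1) / s) ^ (1 / (p - 1))) (𝓝[>] 0) (𝓝 ℓ₀) := by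
    refine hℓ₀.congr' ?_
    filter_upwards [Ioo_mem_nhdsGT (one_pos (α := ℝ))] with s hs
    have hd := (hyp.d_pos s hs).le
    have hρ := (hyp.ρ_pos s hs).le
    have hs0 := hs.1.le
    rw [Real.div_rpow (by positivity) hs0, Real.mul_rpow hd (by positivity), one_div,
      Real.rpow_rpow_inv hρ hp.ne']
    ring
  -- The profile lives on `[0, 1]`, so `δ` is cut down to at most `1`.
  have hδ' : 0 < min δ 1 := lt_min hδ one_pos
  have hξ' := hξ.mono (Icc_subset_Icc_right (min_le_left δ 1))
  have hchain' : ∀ s ∈ Ioo (0 : ℝ) (min δ 1),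
      μ * ξ s ≤ d s * ρ s ^ (p - 1) ∧ d s * ρ s ^ (p - 1) ≤ M * ξ s := fun s hs =>
    hchain s ⟨hs.1, hs.2.trans_le (min_le_left _ _)⟩
  obtain ⟨k, hk, hlow⟩ := hy.exists_mul_le hq (hcont c) hδ' (min_le_right _ _) hμ hM hξ' hchain'
  obtain ⟨K, hK, hup⟩ : ∃ K > 0, ∀ᶠ s in 𝓝[>] 0, y s ≤ K * (d s * ρ s ^ (p - 1)) := by
    have hnn : 0 ≤ ℓ₀ := by
      refine ge_of_tendsto hlim ?_
      filter_upwards [Ioo_mem_nhdsGT (one_pos (α := ℝ))] with s hs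
      exact Real.rpow_nonneg (div_nonneg (hr s hs).le hs.1.le) _
    rcases hnn.eq_or_lt with rfl | hℓpos
    · exact hy.exists_le_mul_of_zero hq hr hy₀ (hcont c) (hcont c₀) hlt0 hpos hlim hδ'
        (min_le_right _ _) hμ hM hξ' hchain'
    · exact hy.exists_le_mul_of_pos hq (hcont c) hr hℓpos hlim
  refine ⟨k ^ (1 / (p - 1)), by positivity, K ^ (1 / (p - 1)), by positivity, ?_⟩
  have hmem : ∀ᶠ t in leftOf β, t ∈ realInterval α β := by
    obtain ⟨t₀, h1, h2⟩ := EReal.lt_iff_exists_real_btwn.1 hu.lt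
    exact (eventually_leftOf_iff hu.lt).2 ⟨t₀, ⟨h1, h2⟩, fun t ht htβ =>
      ⟨h1.trans (EReal.coe_lt_coe_iff.2 ht), htβ⟩⟩
  filter_upwards [hu.tendsto_nhdsGT.eventually hlow, hu.tendsto_nhdsGT.eventually hup, hmem]
    with t h1 h2 ht
  have hut := hu.u_mem t ht
  have hd := hyp.d_pos _ hut
  have hρ := hyp.ρ_pos _ hut
  have hyt := hy.pos _ hut
  have hpow : ∀ a : ℝ, 0 < a →
      a ^ (1 / (p - 1)) * ρ (u t) = (a * ρ (u t) ^ (p - 1)) ^ (1 / (p - 1)) := by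
    intro a ha
    rw [Real.mul_rpow ha.le (by positivity), one_div, Real.rpow_rpow_inv hρ.le hp.ne']
  rw [hyu t ht, hpow k hk, hpow K hK]
  constructor
  · refine Real.rpow_le_rpow (by positivity) ?_ hq.le
    rw [le_div_iff₀ hd]
    linarith
  · refine Real.rpow_le_rpow (by positivity) ?_ hq.le
    rw [div_le_iff₀ hd]
    linarith

theorem tendsto_deriv_zero (hyp : StructuralHypotheses p d f g ρ)
    (hu : IsTravelingWave p d f g ρ c α β u) {k K : ℝ}
    (h : ∀ᶠ t in leftOf β, k * ρ (u t) ≤ -deriv u t ∧ -deriv u t ≤ K * ρ (u t)) :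
    Tendsto (deriv u) (leftOf β) (𝓝 0) := by
  have hρ : Tendsto (fun t => ρ (u t)) (leftOf β) (𝓝 0) := by
    have := (tendsto_nhdsGT_zero_of_continuousOn hyp.ρ_cont).comp hu.tendsto_nhdsGT
    rwa [hyp.ρ_zero] at this
  have h1 := (hρ.const_mul K).neg
  have h2 := (hρ.const_mul k).neg
  rw [mul_zero, neg_zero] at h1 h2
  refine tendsto_of_tendsto_of_tendsto_of_le_of_le' h1 h2 ?_ ?_
  · filter_upwards [h] with t ht
    linarith [ht.2]
  · filter_upwards [h] with t ht
    linarith [ht.1]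

end IsTravelingWave

theorem theorem5p1 (p : ℝ) (d f g ρ : ℝ → ℝ) (hyp : StructuralHypotheses p d f g ρ)
    (ℓ₀ : ℝ)
    (hℓ₀ : Tendsto (fun u : ℝ => ρ u * (d u ^ (1 / (p - 1)) / u ^ (1 / (p - 1)))) (𝓝[>] 0) (𝓝 ℓ₀))
    (c : ℝ) (hc : thresholdSpeed p d f g ρ < c)
    (α β : EReal) (u : ℝ → ℝ) (hu : IsTravelingWave p d f g ρ c α β u)
    (δ μ M : ℝ) (hδ : 0 < δ) (hμ : 0 < μ) (hM : 0 < M)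
    (ξ : ℝ → ℝ) (hξ : ContDiffOn ℝ 1 ξ (Icc 0 δ))
    (hchain : ∀ s ∈ Ioo (0 : ℝ) δ,
      μ * ξ s ≤ d s * ρ s ^ (p - 1) ∧ d s * ρ s ^ (p - 1) ≤ M * ξ s) :
    (β = ⊤ ↔ ∫⁻ s in Ioo (0 : ℝ) (1 / 2), ENNReal.ofReal (1 / ρ s) = ⊤) ∧
    Tendsto (deriv u) (leftOf β) (𝓝 0) ∧
    (β < ⊤ → ContDiffOn ℝ 1 (zeroExtension β u) {t : ℝ | α < (t : EReal)}) := by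
  -- The comparison wave needs only some admissible speed below `c`; the threshold itself need not
  -- be shown admissible.
  obtain ⟨c₀, hc₀, hlt⟩ := exists_lt_of_csInf_lt
    (s := admissibleSpeeds p d f g ρ) ⟨c, α, β, u, hu⟩ hc
  obtain ⟨k, hk, K, -, hbd⟩ :=
    hu.exists_slope_bounds hyp hℓ₀ hc₀ hlt hδ hμ hM hξ hchain
  have hderiv := hu.tendsto_deriv_zero hyp hbd
  refine ⟨hu.top_iff_lintegral_eq_top hyp hk hbd, hderiv, fun hβ => ?_⟩
  lift β to ℝ using ⟨hβ.ne, (bot_le.trans_lt hu.lt).ne'⟩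
  exact contDiffOn_zeroExtension hu.lt hu.u_C1 hu.u_right hderiv
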